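/- Let $W$ denote the principal branch of the Lambert $W$ function, holomorphic on $\mathbb{C}\setminus(-\infty,-1/e]$, with $W(z)e^{W(z)}=z$ and $W(0)=0$. A function $f:(0,\infty)\to\mathbb{R}$ is called a Stieltjes function if there are a constant $c\ge 0$ and a positive measure $\mu$ on $[0,\infty)$ with $\int_{[0,\infty)}(1+t)^{-1}\,d\mu(t)<\infty$ such that $$f(x)=c+\int_{[0,\infty)}\frac{d\mu(t)}{x+t}\qquad\text{for all } x>0 .$$ Theorem. Let $a$ be a real number with $0<a\le e$. Then the functions $$F_0(z)=\frac{z}{1+z}\,\frac{W(a(1+z))}{\left[W(a(1+z))-W(a)\right]^2},\qquad F_1(z)=\frac{z\,W\!\left(\frac{a}{1+z}\right)}{\left[W(a)-W\!\left(\frac{a}{1+z}\right)\right]^2}$$ are Stieltjes functions; that is, each of them is holomorphic on the cut plane $\mathbb{C}\setminus(-\infty,0]$, and its restriction to $(0,\infty)$ is a real-valued Stieltjes function. -/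

import Mathlib

/-- The range of the principal branch of the Lambert `W` function: the region of the strip
`|Im w| < π` to the right of the curve `u = -v cot v` (`-π < v < π`, where the curve passes through
`-1` at `v = 0`), together with the part `0 ≤ v` of this curve, which is the image of the branch cut
`(-∞, -1/e]` under the convention that the branch is continuous onto the cut from above. -/
def lambertWRange : Set ℂ :=
  {w | (w.im = 0 ∧ -1 ≤ w.re) ∨
    (0 < w.im ∧ w.im < Real.pi ∧ -(w.im * Real.cot w.im) ≤ w.re) ∨
    (-Real.pi < w.im ∧ w.im < 0 ∧ -(w.im * Real.cot w.im) < w.re)}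

/-- The principal branch of the Lambert `W` function: `lambertW z` is the unique solution `w` of
`w * exp w = z` that lies in the range of the principal branch. -/
noncomputable def lambertW (z : ℂ) : ℂ :=
  Classical.epsilon fun w : ℂ => w ∈ lambertWRange ∧ w * Complex.exp w = z

/-- `f` (of which only the values on `(0, ∞)` matter) is a Stieltjes function:
`f x = c + ∫ dμ(t) / (x + t)` for all `x > 0`, with a constant `c ≥ 0` and a positive measure `μ`
on `[0, ∞)` such that `∫ dμ(t) / (1 + t) < ∞`. -/
def IsStieltjesFunction (f : ℝ → ℝ) : Prop :=
  ∃ c : ℝ, 0 ≤ c ∧ ∃ μ : MeasureTheory.Measure ℝ, μ (Set.Iio 0) = 0 ∧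
    MeasureTheory.Integrable (fun t : ℝ => (1 + t)⁻¹) μ ∧
    ∀ x : ℝ, 0 < x → f x = c + ∫ t, (x + t)⁻¹ ∂μ

/-- A function `F` of a complex variable is a Stieltjes function on the cut plane `ℂ \ (-∞, 0]`:
it is holomorphic there, and its restriction to `(0, ∞)` is a (real-valued) Stieltjes function. -/
def IsStieltjesOnCutPlane (F : ℂ → ℂ) : Prop :=
  DifferentiableOn ℂ F Complex.slitPlane ∧
    ∃ f : ℝ → ℝ, IsStieltjesFunction f ∧ ∀ x : ℝ, 0 < x → F x = f x

/-- `z / (1 + z) * W(a (1 + z)) / [W(a (1 + z)) - W(a)] ^ 2` -/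
noncomputable def sokalF0 (a : ℝ) (z : ℂ) : ℂ :=
  z / (1 + z) * lambertW (a * (1 + z)) / (lambertW (a * (1 + z)) - lambertW a) ^ 2

/-- `z * W(a / (1 + z)) / [W(a) - W(a / (1 + z))] ^ 2` -/
noncomputable def sokalF1 (a : ℝ) (z : ℂ) : ℂ :=
  z * lambertW (a / (1 + z)) / (lambertW a - lambertW (a / (1 + z))) ^ 2

/-!
Write `ζ` for the argument of `W` and put `P(ζ) = exp (-W(ζ)) * ((ζ - a) / (W(ζ) - W(a))) ^ 2`
(`lambertP`), which is regular at `ζ = a`. As `exp (-W(ζ)) = W(ζ) / ζ`, both functions are values of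
`H(ζ) = P(ζ) / (ζ - a)`: one has `F₀(z) = H(a (1 + z))` and `F₁(z) = -H(a / (1 + z))`. It is
therefore enough to show that `H` is a simple pole at `a` with positive residue `P(a)` plus
`∫ ρ(t) / (ζ + t) dt` with a density `ρ ≥ 0` on `(0, ∞)`.

The divided difference `(P(ζ) - P(a)) / (ζ - a)` is holomorphic on the slit plane, continuous up to
the upper side of the cut, and tends to `0` at infinity because `|W(ζ)| → ∞`. Cauchy's theorem in
the variable `log ζ`, on the rectangles `[-R, R] × [0, π]`, represents it by the imaginary part of
its boundary values (`tendsto_integral_im_neg_exp`, `tendsto_integral_lambertDensity`). The sign of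
the density comes from `Im (w / (w - b) ^ 2) = Im w * (b ^ 2 - |w| ^ 2) / |w - b| ^ 4` with
`b = W(a)`: on the image of the cut `|w| = v / sin v ≥ 1`, while `a ≤ e` says `b ≤ 1`
(`lambertP_neg_im_nonneg`). For `F₁` the constant term is `P(a) / a - ∫ ρ(t) / t dt`; it is
nonnegative because `H < 0` on `(0, a)` (`integrable_lambertDensity_and_integral_le`).

The boundary behaviour of `W` is obtained by inverting `w * exp w` from the closed region
`lambertUpper` to the closed upper half-plane. It is injective there because, with `p = log w`, the
function `p + exp p` has derivative of positive imaginary part on the strip `0 < Im p < π`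
(`eq_of_add_exp_eq`); it is surjective because it is open and proper (`exists_mem_lambertUpper`);
properness also yields the continuity of the inverse (`tendsto_lambertW`).
-/

open Complex Filter Topology Set
open scoped ComplexConjugate

/-! ### The closed region onto which the closed upper half-plane is mapped -/

/-- The part of `lambertWRange` in the closed upper half-plane, described by closed conditions:
`w * exp w` lies in the closed upper half-plane as well (see `mem_lambertWRange_iff_of_im_nonneg`). -/
def lambertUpper : Set ℂ :=
  {w | 0 ≤ w.im ∧ w.im ≤ Real.pi ∧ -1 ≤ w.re ∧ 0 ≤ (w * exp w).im}

lemma im_mul_exp (w : ℂ) :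
    (w * exp w).im = Real.exp w.re * (w.re * Real.sin w.im + w.im * Real.cos w.im) := by
  rw [mul_im, exp_re, exp_im]; ring

lemma isClosed_lambertUpper : IsClosed lambertUpper := by
  unfold lambertUpper
  refine IsClosed.inter (s₁ := {w : ℂ | 0 ≤ w.im}) ?_
    (IsClosed.inter (s₁ := {w : ℂ | w.im ≤ Real.pi}) ?_
      (IsClosed.inter (s₁ := {w : ℂ | -1 ≤ w.re})
        (s₂ := {w : ℂ | 0 ≤ (w * exp w).im}) ?_ ?_))
  · exact isClosed_le continuous_const continuous_im
  · exact isClosed_le continuous_im continuous_const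
  · exact isClosed_le continuous_const continuous_re
  · exact isClosed_le continuous_const (by fun_prop)

lemma mul_cos_le_sin_of_le_pi {v : ℝ} (h0 : 0 ≤ v) (h1 : v ≤ Real.pi) :
    v * Real.cos v ≤ Real.sin v := by
  have hmono : MonotoneOn (fun v => Real.sin v - v * Real.cos v) (Icc 0 Real.pi) := by
    refine monotoneOn_of_deriv_nonneg (convex_Icc _ _) (by fun_prop) (by fun_prop) ?_
    intro x hx
    rw [interior_Icc] at hx
    have hd : HasDerivAt (fun v => Real.sin v - v * Real.cos v)
        (Real.cos x - (1 * Real.cos x + x * (-Real.sin x))) x :=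
      (Real.hasDerivAt_sin x).sub ((hasDerivAt_id x).mul (Real.hasDerivAt_cos x))
    rw [hd.deriv]
    have := mul_nonneg hx.1.le (Real.sin_pos_of_mem_Ioo hx).le
    linarith
  have := hmono (left_mem_Icc.2 Real.pi_pos.le) ⟨h0, h1⟩ h0
  simp only [Real.sin_zero, zero_mul, sub_zero] at this
  linarith

lemma neg_one_le_re_of_im_mul_exp_nonneg {w : ℂ} (h0 : 0 < w.im) (h1 : w.im < Real.pi)
    (h : 0 ≤ (w * exp w).im) : -1 ≤ w.re := by
  rw [im_mul_exp] at h
  have h2 := nonneg_of_mul_nonneg_right h (Real.exp_pos w.re)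
  have h3 := mul_cos_le_sin_of_le_pi h0.le h1.le
  have h4 := Real.sin_pos_of_pos_of_lt_pi h0 h1
  by_contra! hlt
  nlinarith

lemma neg_mul_cot_le_iff {u v : ℝ} (h0 : 0 < v) (h1 : v < Real.pi) :
    -(v * Real.cot v) ≤ u ↔ 0 ≤ u * Real.sin v + v * Real.cos v := by
  have h4 := Real.sin_pos_of_pos_of_lt_pi h0 h1
  have : u * Real.sin v + v * Real.cos v = (u + v * Real.cot v) * Real.sin v := by
    rw [Real.cot_eq_cos_div_sin]; field_simp
  rw [this, mul_nonneg_iff_of_pos_right h4]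
  constructor <;> intro <;> linarith

lemma im_lt_pi_of_mem_lambertUpper {w : ℂ} (hw : w ∈ lambertUpper) : w.im < Real.pi := by
  obtain ⟨_, h1, _, h3⟩ := hw
  refine lt_of_le_of_ne h1 fun h => ?_
  rw [im_mul_exp, h, Real.sin_pi, Real.cos_pi] at h3
  have := nonneg_of_mul_nonneg_right h3 (Real.exp_pos w.re)
  linarith [Real.pi_pos]

lemma mem_lambertWRange_iff_of_im_nonneg {w : ℂ} (h : 0 ≤ w.im) :
    w ∈ lambertWRange ↔ w ∈ lambertUpper := by
  constructor
  · rintro (⟨h0, h1⟩ | ⟨h0, h1, h2⟩ | ⟨_, h0, _⟩)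
    · exact ⟨h, h0 ▸ Real.pi_pos.le, h1, by rw [im_mul_exp, h0]; simp⟩
    · have h3 : 0 ≤ (w * exp w).im := by
        rw [im_mul_exp]
        exact mul_nonneg (Real.exp_pos _).le ((neg_mul_cot_le_iff h0 h1).1 h2)
      exact ⟨h, h1.le, neg_one_le_re_of_im_mul_exp_nonneg h0 h1 h3, h3⟩
    · exact absurd h (not_le.2 h0)
  · intro hw
    have hpi := im_lt_pi_of_mem_lambertUpper hw
    rcases h.eq_or_lt with h0 | h0
    · exact Or.inl ⟨h0.symm, hw.2.2.1⟩
    · refine Or.inr (Or.inl ⟨h0, hpi, (neg_mul_cot_le_iff h0 hpi).2 ?_⟩)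
      have := hw.2.2.2
      rw [im_mul_exp] at this
      exact nonneg_of_mul_nonneg_right this (Real.exp_pos w.re)

lemma conj_mul_exp (w : ℂ) : conj w * exp (conj w) = conj (w * exp w) := by
  rw [map_mul, exp_conj]

lemma mem_lambertWRange_iff_of_im_neg {w : ℂ} (h : w.im < 0) :
    w ∈ lambertWRange ↔ conj w ∈ lambertUpper ∧ (w * exp w).im < 0 := by
  have hkey : ∀ h1 : -Real.pi < w.im,
      (-(w.im * Real.cot w.im) < w.re ↔ (w * exp w).im < 0) := by
    intro h1
    have h4 := Real.sin_pos_of_pos_of_lt_pi (neg_pos.2 h) (by linarith : -w.im < Real.pi)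
    rw [Real.sin_neg] at h4
    have : (w * exp w).im =
        -((w.re + w.im * Real.cot w.im) * (Real.exp w.re * -Real.sin w.im)) := by
      have hne : Real.sin w.im ≠ 0 := by linarith
      rw [im_mul_exp, Real.cot_eq_cos_div_sin]; field_simp
    rw [this, neg_lt_zero, mul_pos_iff_of_pos_right (mul_pos (Real.exp_pos _) h4)]
    constructor <;> intro <;> linarith
  have him : (conj w * exp (conj w)).im = -(w * exp w).im := by rw [conj_mul_exp, conj_im]
  constructor
  · rintro (⟨h0, _⟩ | ⟨h0, _⟩ | ⟨h1, h0, h2⟩)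
    · exact absurd h0 h.ne
    · exact absurd h0 h.not_gt
    · have h3 := (hkey h1).1 h2
      refine ⟨⟨by simp [h.le], by simp; linarith, ?_, by linarith⟩, h3⟩
      exact neg_one_le_re_of_im_mul_exp_nonneg (by simpa using h) (by simp; linarith) (by linarith)
  · rintro ⟨hw, h3⟩
    have := im_lt_pi_of_mem_lambertUpper hw
    rw [conj_im] at this
    exact Or.inr (Or.inr ⟨by linarith, h, (hkey (by linarith)).2 h3⟩)

/-! ### Bijectivity of `w * exp w` from this region to the closed upper half-plane -/

/-- On the strip `0 ≤ Im p ≤ π` the derivative `1 + exp p` of `p + exp p` has positive imaginary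
part away from the boundary. By the mean value theorem along the segment from `p` to `q` the
function is injective, as long as that segment does not run inside the boundary. -/
lemma eq_of_add_exp_eq {p q : ℂ} (hp0 : 0 ≤ p.im) (hp1 : p.im ≤ Real.pi) (hq0 : 0 ≤ q.im)
    (hq1 : q.im ≤ Real.pi) (h0 : 0 < p.im + q.im) (h1 : p.im + q.im < 2 * Real.pi)
    (h : p + exp p = q + exp q) : p = q := by
  by_contra hne
  have hd : q - p ≠ 0 := sub_ne_zero.2 (Ne.symm hne)
  let g : ℝ → ℂ := fun t => ((p + t * (q - p)) + exp (p + t * (q - p))) / (q - p)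
  have hg : ∀ t : ℝ, HasDerivAt g (1 + exp (p + t * (q - p))) t := by
    intro t
    have hin : HasDerivAt (fun t : ℝ => p + t * (q - p)) (q - p) t := by
      simpa using (((hasDerivAt_id (t : ℂ)).mul_const (q - p)).const_add p).comp_ofReal
    refine ((hin.add hin.cexp).div_const (q - p)).congr_deriv ?_
    field_simp
  have hgim : ∀ t : ℝ, HasDerivAt (fun t => (g t).im) (1 + exp (p + t * (q - p))).im t := fun t =>
    imCLM.hasFDerivAt.comp_hasDerivAt t (hg t)
  have hmono : StrictMonoOn (fun t => (g t).im) (Icc 0 1) := by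
    refine strictMonoOn_of_deriv_pos (convex_Icc _ _)
      (fun t _ => (hgim t).continuousAt.continuousWithinAt) ?_
    intro t ht
    rw [interior_Icc] at ht
    rw [(hgim t).deriv]
    have him : (p + t * (q - p)).im = (1 - t) * p.im + t * q.im := by
      simp; ring
    have hpos : 0 < (1 - t) * p.im + t * q.im := by
      rcases hp0.eq_or_lt with hp | hp
      · rw [← hp] at h0 ⊢
        have := mul_pos ht.1 (by linarith : 0 < q.im)
        linarith
      · have := mul_pos (by linarith [ht.2] : 0 < 1 - t) hp
        have := mul_nonneg ht.1.le hq0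
        linarith
    have hlt : (1 - t) * p.im + t * q.im < Real.pi := by
      rcases hp1.eq_or_lt with hp | hp
      · have := mul_pos ht.1 (by linarith : 0 < Real.pi - q.im)
        rw [hp]; linarith
      · have := mul_pos (by linarith [ht.2] : 0 < 1 - t) (sub_pos.2 hp)
        have := mul_nonneg ht.1.le (sub_nonneg.2 hq1)
        linarith
    rw [add_im, one_im, zero_add, exp_im, him]
    exact mul_pos (Real.exp_pos _) (Real.sin_pos_of_pos_of_lt_pi hpos hlt)
  have := hmono (left_mem_Icc.2 zero_le_one) (right_mem_Icc.2 zero_le_one) zero_lt_one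
  refine this.ne ?_
  simp only [g]
  simp [h]

/-- For `w = |w| exp (i α)` the number `w * exp w` has argument `α + Im w`, without wrapping
around. -/
lemma arg_add_im_le_pi {w : ℂ} (hw : w ∈ lambertUpper) (hw0 : w ≠ 0) : arg w + w.im ≤ Real.pi := by
  by_contra! hlt
  have hv := im_lt_pi_of_mem_lambertUpper hw
  have h1 := arg_le_pi w
  have hs : 0 < Real.sin (arg w + w.im - Real.pi) :=
    Real.sin_pos_of_pos_of_lt_pi (by linarith) (by linarith)
  rw [Real.sin_sub_pi] at hs
  have h3 := hw.2.2.2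
  rw [im_mul_exp] at h3
  have h3 := nonneg_of_mul_nonneg_right h3 (Real.exp_pos w.re)
  have h4 : w.re * Real.sin w.im + w.im * Real.cos w.im = ‖w‖ * Real.sin (arg w + w.im) := by
    rw [Real.sin_add]
    linear_combination (-Real.sin w.im) * norm_mul_cos_arg w -
      Real.cos w.im * norm_mul_sin_arg w
  have := mul_pos (norm_pos_iff.2 hw0) hs
  linarith

lemma log_mul_exp_of_mem_lambertUpper {w : ℂ} (hw : w ∈ lambertUpper) (hw0 : w ≠ 0) :
    log w + w = log (w * exp w) := by
  have h : w * exp w = exp (log w + w) := by rw [exp_add, exp_log hw0]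
  have h0 : 0 ≤ arg w := arg_nonneg_iff.2 hw.1
  rw [h, log_exp]
  · rw [add_im, log_im]; linarith [hw.1, Real.pi_pos]
  · rw [add_im, log_im]; exact arg_add_im_le_pi hw hw0

lemma strictMonoOn_mul_exp : StrictMonoOn (fun x : ℝ => x * Real.exp x) (Ici (-1)) := by
  refine strictMonoOn_of_deriv_pos (convex_Ici _) (by fun_prop) ?_
  intro x hx
  rw [interior_Ici] at hx
  have hd : HasDerivAt (fun x : ℝ => x * Real.exp x) (1 * Real.exp x + x * Real.exp x) x :=
    (hasDerivAt_id x).mul (Real.hasDerivAt_exp x)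
  rw [hd.deriv, ← add_mul]
  exact mul_pos (by linarith [mem_Ioi.1 hx]) (Real.exp_pos x)

lemma injOn_mul_exp_lambertUpper : InjOn (fun w : ℂ => w * exp w) lambertUpper := by
  intro w hw z hz h
  simp only at h
  have hzero : w = 0 ↔ z = 0 := by
    constructor <;> rintro rfl
    · simpa [exp_ne_zero] using h.symm
    · simpa [exp_ne_zero] using h
  by_cases hw0 : w = 0
  · rw [hw0, hzero.1 hw0]
  have hz0 : z ≠ 0 := fun hh => hw0 (hzero.2 hh)
  by_cases hre : w.im = 0 ∧ z.im = 0
  · have ew : w = (w.re : ℂ) := Complex.ext rfl (by simp [hre.1])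
    have ez : z = (z.re : ℂ) := Complex.ext rfl (by simp [hre.2])
    rw [ew, ez] at h
    have h' : w.re * Real.exp w.re = z.re * Real.exp z.re := by exact_mod_cast h
    rw [ew, ez, strictMonoOn_mul_exp.injOn hw.2.2.1 hz.2.2.1 h']
  have key : log w + w = log z + z := by
    rw [log_mul_exp_of_mem_lambertUpper hw hw0, log_mul_exp_of_mem_lambertUpper hz hz0, h]
  have hbd : ∀ y : ℂ, y ∈ lambertUpper → 0 ≤ (log y).im ∧ (log y).im ≤ Real.pi := fun y hy =>
    ⟨by rw [log_im]; exact arg_nonneg_iff.2 hy.1, by rw [log_im]; exact arg_le_pi y⟩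
  have hin : ∀ y : ℂ, y ∈ lambertUpper → y.im ≠ 0 → 0 < (log y).im ∧ (log y).im < Real.pi := by
    intro y hy hy0
    refine ⟨lt_of_le_of_ne (hbd y hy).1 fun hh => hy0 ?_,
      lt_of_le_of_ne (hbd y hy).2 fun hh => hy0 ?_⟩
    · rw [log_im] at hh; exact (arg_eq_zero_iff.1 hh.symm).2
    · rw [log_im] at hh; exact (arg_eq_pi_iff.1 hh).2
  have hlog : log w = log z := by
    have e1 : log w + exp (log w) = log z + exp (log z) := by
      rw [exp_log hw0, exp_log hz0, key]
    rcases not_and_or.1 hre with hh | hh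
    · exact eq_of_add_exp_eq (hbd w hw).1 (hbd w hw).2 (hbd z hz).1 (hbd z hz).2
        (by linarith [(hin w hw hh).1, (hbd z hz).1])
        (by linarith [(hin w hw hh).2, (hbd z hz).2]) e1
    · exact eq_of_add_exp_eq (hbd w hw).1 (hbd w hw).2 (hbd z hz).1 (hbd z hz).2
        (by linarith [(hin z hz hh).1, (hbd w hw).1])
        (by linarith [(hin z hz hh).2, (hbd w hw).2]) e1
  rw [← exp_log hw0, ← exp_log hz0, hlog]

lemma norm_le_of_neg_one_le_re {w : ℂ} (h : -1 ≤ w.re) :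
    ‖w‖ ≤ Real.exp 1 * ‖w * exp w‖ := by
  rw [norm_mul, norm_exp]
  have h1 : 1 ≤ Real.exp 1 * Real.exp w.re := by
    rw [← Real.exp_add]; exact Real.one_le_exp (by linarith)
  nlinarith [norm_nonneg w]

lemma isClosed_image_lambertUpper : IsClosed ((fun w : ℂ => w * exp w) '' lambertUpper) := by
  refine isClosed_of_closure_subset fun ζ hζ => ?_
  obtain ⟨x, hx, hlim⟩ := mem_closure_iff_seq_limit.1 hζ
  choose w hw hwx using hx
  obtain ⟨C, hC⟩ := (Metric.isBounded_range_of_tendsto x hlim).exists_norm_le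
  have hb : ∀ n, w n ∈ Metric.closedBall (0 : ℂ) (Real.exp 1 * C) := fun n => by
    rw [mem_closedBall_zero_iff]
    refine (norm_le_of_neg_one_le_re (hw n).2.2.1).trans ?_
    exact mul_le_mul_of_nonneg_left (by simpa only [hwx n] using hC _ (mem_range_self n))
      (Real.exp_pos 1).le
  obtain ⟨w', -, φ, hφ, hw'⟩ := tendsto_subseq_of_bounded Metric.isBounded_closedBall hb
  refine ⟨w', isClosed_lambertUpper.mem_of_tendsto hw' (Eventually.of_forall fun n => hw _), ?_⟩
  have hcont : Continuous fun w : ℂ => w * exp w := by fun_prop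
  have h1 := (hcont.tendsto w').comp hw'
  have h2 := hlim.comp hφ.tendsto_atTop
  refine tendsto_nhds_unique h1 (h2.congr fun n => (hwx _).symm)

lemma hasStrictDerivAt_mul_exp (w : ℂ) :
    HasStrictDerivAt (fun w : ℂ => w * exp w) ((1 + w) * exp w) w := by
  refine ((hasStrictDerivAt_id w).mul (hasStrictDerivAt_exp w)).congr_deriv ?_
  simp only [id]; ring

/-- The image of the interior of `lambertUpper` is open and relatively closed in the open upper
half-plane, hence all of it; the boundary points follow because the whole image is closed. -/
lemma exists_mem_lambertUpper {ζ : ℂ} (hζ : 0 ≤ ζ.im) :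
    ∃ w ∈ lambertUpper, w * exp w = ζ := by
  set f : ℂ → ℂ := fun w => w * exp w with hf
  let R : Set ℂ := {w | 0 < w.im ∧ w.im < Real.pi ∧ 0 < (f w).im}
  have hRsub : R ⊆ lambertUpper := fun w hw =>
    ⟨hw.1.le, hw.2.1.le, neg_one_le_re_of_im_mul_exp_nonneg hw.1 hw.2.1 hw.2.2.le, hw.2.2.le⟩
  have hcont : Continuous f := by fun_prop
  have hRopen : IsOpen R :=
    (isOpen_lt continuous_const continuous_im).inter
      ((isOpen_lt continuous_im continuous_const).inter
        (isOpen_lt continuous_const (continuous_im.comp hcont)))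
  have himg : IsOpen (f '' R) := by
    rw [isOpen_iff_mem_nhds]
    rintro _ ⟨w, hw, rfl⟩
    have hne : (1 + w) * exp w ≠ 0 := by
      refine mul_ne_zero (fun h => ?_) (exp_ne_zero w)
      have := congrArg Complex.im h
      simp at this
      exact hw.1.ne' this
    rw [← (hasStrictDerivAt_mul_exp w).map_nhds_eq hne]
    exact image_mem_map (hRopen.mem_nhds hw)
  have hpre : IsPreconnected {ζ : ℂ | 0 < ζ.im} := (convex_halfSpace_im_gt 0).isPreconnected
  have hne : ({ζ : ℂ | 0 < ζ.im} ∩ f '' R).Nonempty := by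
    have hmem : (1 : ℂ) + (Real.pi / 2 : ℝ) * I ∈ R := by
      refine ⟨by simp [Real.pi_pos], by simp [Real.pi_pos], ?_⟩
      rw [hf]
      simp only [im_mul_exp]
      simp [Real.exp_pos]
    exact ⟨_, hmem.2.2, mem_image_of_mem f hmem⟩
  have hsub : {ζ : ℂ | 0 < ζ.im} ⊆ f '' R := by
    refine hpre.subset_of_closure_inter_subset himg hne ?_
    rintro z ⟨hz, hz0⟩
    have : z ∈ f '' lambertUpper :=
      closure_minimal (image_mono hRsub) isClosed_image_lambertUpper hz
    obtain ⟨w, hw, rfl⟩ := this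
    have hz0 : 0 < (f w).im := hz0
    refine ⟨w, ⟨lt_of_le_of_ne hw.1 fun h => ?_, im_lt_pi_of_mem_lambertUpper hw, hz0⟩, rfl⟩
    rw [hf] at hz0
    simp only [im_mul_exp] at hz0
    simp [← h] at hz0
  have hcl : closure {ζ : ℂ | 0 < ζ.im} ⊆ f '' lambertUpper :=
    closure_minimal (hsub.trans (image_mono hRsub)) isClosed_image_lambertUpper
  rw [closure_setOfPred_lt_im] at hcl
  exact hcl hζ

/-! ### The principal branch on the closed upper half-plane and on the slit plane -/

lemma lambertW_spec_of_im_nonneg {ζ : ℂ} (hζ : 0 ≤ ζ.im) :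
    lambertW ζ ∈ lambertUpper ∧ lambertW ζ * exp (lambertW ζ) = ζ := by
  obtain ⟨w, hw, hwζ⟩ := exists_mem_lambertUpper hζ
  have hspec : lambertW ζ ∈ lambertWRange ∧ lambertW ζ * exp (lambertW ζ) = ζ :=
    Classical.epsilon_spec
      (p := fun w : ℂ => w ∈ lambertWRange ∧ w * exp w = ζ)
      ⟨w, (mem_lambertWRange_iff_of_im_nonneg hw.1).2 hw, hwζ⟩
  refine ⟨?_, hspec.2⟩
  rcases le_or_gt 0 (lambertW ζ).im with h | h
  · exact (mem_lambertWRange_iff_of_im_nonneg h).1 hspec.1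
  · have := ((mem_lambertWRange_iff_of_im_neg h).1 hspec.1).2
    rw [hspec.2] at this
    exact absurd hζ (not_le.2 this)

lemma lambertW_mul_exp_of_mem_lambertUpper {w : ℂ} (hw : w ∈ lambertUpper) :
    lambertW (w * exp w) = w := by
  obtain ⟨h1, h2⟩ := lambertW_spec_of_im_nonneg (ζ := w * exp w) hw.2.2.2
  exact injOn_mul_exp_lambertUpper h1 hw h2

lemma lambertW_of_im_neg {ζ : ℂ} (hζ : ζ.im < 0) : lambertW ζ = conj (lambertW (conj ζ)) := by
  obtain ⟨h1, h2⟩ := lambertW_spec_of_im_nonneg (ζ := conj ζ) (by simpa using hζ.le)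
  set w := lambertW (conj ζ) with hw
  have him : (w * exp w).im = -ζ.im := by rw [h2, conj_im]
  have hw0 : 0 < w.im := by
    refine lt_of_le_of_ne h1.1 fun h => ?_
    rw [im_mul_exp, ← h] at him
    simp at him
    exact hζ.ne him
  have hval : conj w * exp (conj w) = ζ := by rw [conj_mul_exp, h2, conj_conj]
  have hmem : conj w ∈ lambertWRange :=
    (mem_lambertWRange_iff_of_im_neg (by simpa using hw0)).2
      ⟨by rwa [conj_conj], by rwa [hval]⟩
  have hspec : lambertW ζ ∈ lambertWRange ∧ lambertW ζ * exp (lambertW ζ) = ζ :=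
    Classical.epsilon_spec
      (p := fun w : ℂ => w ∈ lambertWRange ∧ w * exp w = ζ) ⟨_, hmem, hval⟩
  have hneg : (lambertW ζ).im < 0 := by
    by_contra! h
    have := ((mem_lambertWRange_iff_of_im_nonneg h).1 hspec.1).2.2.2
    rw [hspec.2] at this
    exact absurd hζ (not_lt.2 this)
  have hU := ((mem_lambertWRange_iff_of_im_neg hneg).1 hspec.1).1
  have : conj (lambertW ζ) = w :=
    injOn_mul_exp_lambertUpper hU h1 (by simp only [conj_mul_exp, hspec.2, h2])
  rw [← this, conj_conj]

lemma lambertW_mul_exp (ζ : ℂ) : lambertW ζ * exp (lambertW ζ) = ζ := by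
  rcases le_or_gt 0 ζ.im with h | h
  · exact (lambertW_spec_of_im_nonneg h).2
  · have := (lambertW_spec_of_im_nonneg (ζ := conj ζ) (by simpa using h.le)).2
    rw [lambertW_of_im_neg h, conj_mul_exp, this, conj_conj]

lemma lambertW_ofReal_mul_exp {y : ℝ} (hy : -1 ≤ y) :
    lambertW ((y * Real.exp y : ℝ) : ℂ) = y := by
  have hmem : (y : ℂ) ∈ lambertUpper :=
    ⟨by simp, by simp [Real.pi_pos.le], by simpa using hy, by simp⟩
  have := lambertW_mul_exp_of_mem_lambertUpper hmem
  push_cast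
  exact this

lemma exists_lambertW_ofReal_eq {x : ℝ} (hx : 0 < x) :
    ∃ y : ℝ, 0 < y ∧ y * Real.exp y = x ∧ lambertW x = y := by
  obtain ⟨y, hy, hyx⟩ : x ∈ (fun y : ℝ => y * Real.exp y) '' Icc 0 x := by
    refine intermediate_value_Icc hx.le (by fun_prop) ⟨by simpa using hx.le, ?_⟩
    exact le_mul_of_one_le_right hx.le (Real.one_le_exp hx.le)
  have hyx : y * Real.exp y = x := hyx
  have hy0 : 0 < y := by
    refine lt_of_le_of_ne hy.1 fun h => ?_
    rw [← h, zero_mul] at hyx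
    exact hx.ne hyx
  exact ⟨y, hy0, hyx, by rw [← hyx]; exact lambertW_ofReal_mul_exp (by linarith)⟩

/-- Continuity of the inverse of the proper map `w * exp w`, along a filter: a cluster point
of `lambertW` at `ζ` is again a preimage of `ζ`, and there is only one candidate. -/
lemma tendsto_lambertW {l : Filter ℂ} {ζ : ℂ} {K : Set ℂ} (hl : l ≤ 𝓝 ζ) (hK : IsClosed K)
    (hKre : ∀ w ∈ K, -1 ≤ w.re) (hlK : ∀ᶠ z in l, lambertW z ∈ K)
    (huniq : ∀ w ∈ K, w * exp w = ζ → w = lambertW ζ) :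
    Tendsto lambertW l (𝓝 (lambertW ζ)) := by
  have hcomp : IsCompact (K ∩ Metric.closedBall 0 (Real.exp 1 * (‖ζ‖ + 1))) :=
    (isCompact_closedBall _ _).inter_left hK
  refine hcomp.tendsto_nhds_of_unique_mapClusterPt ?_ ?_
  · have hn : ∀ᶠ z in l, ‖z‖ < ‖ζ‖ + 1 :=
      hl ((continuous_norm.tendsto ζ).eventually (gt_mem_nhds (by linarith)))
    filter_upwards [hlK, hn] with z hz hzn
    refine ⟨hz, ?_⟩
    rw [mem_closedBall_zero_iff]
    refine (norm_le_of_neg_one_le_re (hKre _ hz)).trans ?_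
    rw [lambertW_mul_exp]
    exact mul_le_mul_of_nonneg_left hzn.le (Real.exp_pos 1).le
  · intro w hw hcl
    refine huniq w hw.1 ?_
    have hcont : Continuous fun w : ℂ => w * exp w := by fun_prop
    have h1 := hcl.tendsto_comp (hcont.tendsto w)
    have h2 : ((fun w : ℂ => w * exp w) ∘ lambertW) = id := by
      funext z; exact lambertW_mul_exp z
    rw [h2, mapClusterPt_id_iff] at h1
    exact eq_of_nhds_neBot (h1.mono hl)

lemma continuousOn_lambertW_closedUpper : ContinuousOn lambertW {ζ | 0 ≤ ζ.im} := by
  intro ζ hζ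
  refine tendsto_lambertW nhdsWithin_le_nhds isClosed_lambertUpper (fun w hw => hw.2.2.1) ?_ ?_
  · filter_upwards [self_mem_nhdsWithin] with z hz
    exact (lambertW_spec_of_im_nonneg hz).1
  · rintro w hw rfl
    exact (lambertW_mul_exp_of_mem_lambertUpper hw).symm

/-- Uniqueness in the reflected region. A positive `ζ` lies in both closed half-planes, but its
preimage is real; the branch cut has to be excluded. -/
lemma eq_lambertW_of_conj_mem {w ζ : ℂ} (hζ : ζ ∈ slitPlane) (hw : conj w ∈ lambertUpper)
    (h : w * exp w = ζ) : w = lambertW ζ := by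
  have h1 : lambertW (conj ζ) = conj w := by
    rw [← h, ← conj_mul_exp]; exact lambertW_mul_exp_of_mem_lambertUpper hw
  have h2 := hw.2.2.2
  rw [conj_mul_exp, h, conj_im, neg_nonneg] at h2
  rcases h2.lt_or_eq with h3 | h3
  · rw [lambertW_of_im_neg h3, h1, conj_conj]
  · have hre : 0 < ζ.re := by
      rcases hζ with h4 | h4
      · exact h4
      · exact absurd h3 h4
    have e : ζ = (ζ.re : ℂ) := Complex.ext rfl (by simp [h3])
    obtain ⟨y, -, -, hy⟩ := exists_lambertW_ofReal_eq hre
    rw [e, conj_ofReal, hy] at h1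
    rw [e, hy, ← conj_conj w, ← h1, conj_ofReal]

lemma continuousAt_lambertW {ζ : ℂ} (hζ : ζ ∈ slitPlane) : ContinuousAt lambertW ζ := by
  refine tendsto_lambertW (K := lambertUpper ∪ conj ⁻¹' lambertUpper) le_rfl
    (isClosed_lambertUpper.union (isClosed_lambertUpper.preimage continuous_conj)) ?_ ?_ ?_
  · rintro w (hw | hw)
    · exact hw.2.2.1
    · simpa using hw.2.2.1
  · refine Eventually.of_forall fun z => ?_
    rcases le_or_gt 0 z.im with h | h
    · exact Or.inl (lambertW_spec_of_im_nonneg h).1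
    · refine Or.inr ?_
      rw [mem_preimage, lambertW_of_im_neg h, conj_conj]
      exact (lambertW_spec_of_im_nonneg (by simpa using h.le)).1
  · rintro w (hw | hw) h
    · rw [← h, lambertW_mul_exp_of_mem_lambertUpper hw]
    · exact eq_lambertW_of_conj_mem hζ hw h

lemma differentiableOn_lambertW : DifferentiableOn ℂ lambertW slitPlane := by
  intro ζ hζ
  refine (HasDerivAt.of_local_left_inverse (continuousAt_lambertW hζ)
    (hasStrictDerivAt_mul_exp (lambertW ζ)).hasDerivAt ?_
    (Eventually.of_forall lambertW_mul_exp)).differentiableAt.differentiableWithinAt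
  refine mul_ne_zero (fun h => ?_) (exp_ne_zero _)
  -- The only critical point `-1` corresponds to the branch point `-1 / e`, off the slit plane.
  have h1 : lambertW ζ = ((-1 : ℝ) : ℂ) := by push_cast; linear_combination h
  have h2 := lambertW_mul_exp ζ
  rw [h1, ← ofReal_exp, ← ofReal_mul] at h2
  rw [← h2, ofReal_mem_slitPlane] at hζ
  linarith [Real.exp_pos (-1)]

lemma tendsto_norm_lambertW : Tendsto (fun ζ => ‖lambertW ζ‖) (Bornology.cobounded ℂ) atTop := by
  rw [tendsto_atTop]
  intro M
  have := (tendsto_norm_cobounded_atTop (E := ℂ)).eventually_gt_atTop (|M| * Real.exp |M|)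
  filter_upwards [this] with ζ hζ
  by_contra! h
  refine absurd hζ (not_lt.2 ?_)
  have h' : ‖lambertW ζ‖ ≤ |M| := h.le.trans (le_abs_self M)
  have hre : (lambertW ζ).re ≤ |M| := (re_le_norm _).trans h'
  calc ‖ζ‖ = ‖lambertW ζ * exp (lambertW ζ)‖ := by rw [lambertW_mul_exp]
    _ = ‖lambertW ζ‖ * Real.exp (lambertW ζ).re := by rw [norm_mul, norm_exp]
    _ ≤ |M| * Real.exp |M| := by gcongr

/-! ### A Cauchy integral along the negative axis -/

lemma exp_add_mul_I_im_nonneg {R θ : ℝ} (hθ : θ ∈ Icc 0 Real.pi) :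
    0 ≤ (exp ((R : ℂ) + θ * I)).im := by
  have : 0 ≤ Real.sin θ := Real.sin_nonneg_of_nonneg_of_le_pi hθ.1 hθ.2
  rw [exp_im]
  simp
  positivity

lemma tendsto_integral_exp_add_mul_I {Φ : ℂ → ℂ} {c : ℂ} {l : Filter ℝ} {m : Filter ℂ}
    (hcont : ContinuousOn Φ ({ζ | 0 ≤ ζ.im} \ {0})) (hm : Tendsto Φ m (𝓝 c))
    (hl : Tendsto (fun p : ℝ × ℝ => exp (p.1 + p.2 * I)) (l ×ˢ 𝓟 (Icc 0 Real.pi)) m) :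
    Tendsto (fun R : ℝ => ∫ θ in (0 : ℝ)..Real.pi, Φ (exp (R + θ * I))) l
      (𝓝 (Real.pi * c)) := by
  rw [Metric.tendsto_nhds]
  intro ε hε
  have hε' : 0 < ε / (2 * Real.pi) := by have := Real.pi_pos; positivity
  have h1 := (hm.comp hl).eventually (Metric.ball_mem_nhds c hε')
  rw [eventually_prod_principal_iff] at h1
  filter_upwards [h1] with R hR
  have hint : IntervalIntegrable (fun θ : ℝ => Φ (exp (R + θ * I))) MeasureTheory.volume
      0 Real.pi := by
    refine ContinuousOn.intervalIntegrable ?_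
    rw [uIcc_of_le Real.pi_pos.le]
    exact hcont.comp (by fun_prop) fun θ hθ => ⟨exp_add_mul_I_im_nonneg hθ, exp_ne_zero _⟩
  have hsub : (∫ θ in (0 : ℝ)..Real.pi, Φ (exp (R + θ * I))) - Real.pi * c =
      ∫ θ in (0 : ℝ)..Real.pi, (Φ (exp (R + θ * I)) - c) := by
    rw [intervalIntegral.integral_sub hint (by simp)]
    simp
  rw [dist_eq_norm, hsub]
  have hle : ‖∫ θ in (0 : ℝ)..Real.pi, (Φ (exp (R + θ * I)) - c)‖ ≤
      ε / (2 * Real.pi) * |Real.pi - 0| := by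
    refine intervalIntegral.norm_integral_le_of_norm_le_const fun θ hθ => ?_
    rw [uIoc_of_le Real.pi_pos.le] at hθ
    have := hR θ ⟨hθ.1.le, hθ.2⟩
    simpa [dist_eq_norm] using (le_of_lt this)
  refine hle.trans_lt ?_
  rw [sub_zero, abs_of_pos Real.pi_pos]
  have := Real.pi_pos
  field_simp
  linarith

/-- Cauchy's theorem for `Φ (exp s)` on the rectangles `[-R, R] × [0, π]`: the lower side
contributes only to the real part, the vertical sides contribute the limits of `Φ` at `0` and
at `∞`. -/
lemma tendsto_integral_im_neg_exp {Φ : ℂ → ℂ} {c : ℂ}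
    (hcont : ContinuousOn Φ ({ζ | 0 ≤ ζ.im} \ {0}))
    (hdiff : DifferentiableOn ℂ Φ {ζ | 0 < ζ.im})
    (hreal : ∀ t : ℝ, 0 < t → (Φ t).im = 0)
    (hinf : Tendsto Φ (Bornology.cobounded ℂ) (𝓝 c))
    (hzero : Tendsto Φ (𝓝[{ζ | 0 ≤ ζ.im}] 0) (𝓝 0)) :
    Tendsto (fun R : ℝ => ∫ y in (-R)..R, (Φ (-(Real.exp y : ℝ))).im) atTop
      (𝓝 (Real.pi * c.re)) := by
  have hright : Tendsto (fun R : ℝ => ∫ θ in (0 : ℝ)..Real.pi, Φ (exp (R + θ * I))) atTop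
      (𝓝 (Real.pi * c)) := by
    refine tendsto_integral_exp_add_mul_I hcont hinf ?_
    rw [← tendsto_norm_atTop_iff_cobounded]
    have : (fun p : ℝ × ℝ => ‖exp ((p.1 : ℂ) + p.2 * I)‖) = fun p => Real.exp p.1 := by
      funext p; rw [norm_exp]; simp
    rw [this]
    exact Real.tendsto_exp_atTop.comp tendsto_fst
  have hleft : Tendsto (fun R : ℝ => ∫ θ in (0 : ℝ)..Real.pi, Φ (exp ((-R : ℝ) + θ * I))) atTop
      (𝓝 (Real.pi * 0)) := by
    refine (tendsto_integral_exp_add_mul_I (l := atBot) hcont hzero ?_).comp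
      tendsto_neg_atTop_atBot
    refine tendsto_nhdsWithin_iff.2 ⟨?_, ?_⟩
    · rw [tendsto_zero_iff_norm_tendsto_zero]
      have : (fun p : ℝ × ℝ => ‖exp ((p.1 : ℂ) + p.2 * I)‖) = fun p => Real.exp p.1 := by
        funext p; rw [norm_exp]; simp
      rw [this]
      exact Real.tendsto_exp_atBot.comp tendsto_fst
    · rw [eventually_prod_principal_iff]
      exact Eventually.of_forall fun R θ hθ => exp_add_mul_I_im_nonneg hθ
  have hlim : Tendsto (fun R : ℝ => (∫ θ in (0 : ℝ)..Real.pi, Φ (exp (R + θ * I))).re -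
      (∫ θ in (0 : ℝ)..Real.pi, Φ (exp ((-R : ℝ) + θ * I))).re) atTop (𝓝 (Real.pi * c.re)) := by
    have := ((continuous_re.tendsto _).comp hright).sub ((continuous_re.tendsto _).comp hleft)
    simpa using this
  refine hlim.congr' ?_
  filter_upwards [eventually_gt_atTop 0] with R hR
  have hrect := integral_boundary_rect_eq_zero_of_continuousOn_of_differentiableOn
    (fun s => Φ (exp s)) ⟨-R, 0⟩ ⟨R, Real.pi⟩ ?_ ?_
  · simp only [ofReal_zero, zero_mul, add_zero] at hrect
    have htop : ∀ y : ℝ, exp ((y : ℂ) + Real.pi * I) = -(Real.exp y : ℝ) := fun y => by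
      rw [exp_add, exp_pi_mul_I, mul_neg_one, ofReal_exp]
    have hbot : ∀ y : ℝ, exp (y : ℂ) = (Real.exp y : ℝ) := fun y => (ofReal_exp y).symm
    simp only [htop, hbot] at hrect
    have hposc : ContinuousOn (fun y : ℝ => Φ (Real.exp y : ℝ)) univ :=
      hcont.comp (by fun_prop) fun y _ => ⟨by simp [-ofReal_exp], by simp⟩
    have hnegc : ContinuousOn (fun y : ℝ => Φ (-(Real.exp y : ℝ))) univ :=
      hcont.comp (by fun_prop) fun y _ => ⟨by simp [-ofReal_exp], by simp⟩
    have hi1 := (hposc.mono (subset_univ (uIcc (-R) R))).intervalIntegrable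
      (μ := MeasureTheory.volume)
    have hi2 := (hnegc.mono (subset_univ (uIcc (-R) R))).intervalIntegrable
      (μ := MeasureTheory.volume)
    have e1 := imCLM.intervalIntegral_comp_comm hi1
    have e2 := imCLM.intervalIntegral_comp_comm hi2
    simp only [imCLM_apply] at e1 e2
    have e3 : (∫ y in (-R)..R, (Φ (Real.exp y : ℝ)).im) = 0 := by
      simp only [hreal _ (Real.exp_pos _), intervalIntegral.integral_zero]
    have := congrArg Complex.im hrect
    simp only [sub_im, add_im, smul_eq_mul, I_mul_im, zero_im] at this
    rw [← e1, ← e2, e3] at this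
    linarith
  · refine hcont.comp (by fun_prop) fun s hs => ⟨?_, exp_ne_zero _⟩
    have h2 := hs.2
    simp only [mem_preimage, uIcc_of_le Real.pi_pos.le] at h2
    have := exp_add_mul_I_im_nonneg (R := s.re) h2
    rwa [re_add_im] at this
  · refine hdiff.comp (by fun_prop) fun s hs => ?_
    have h2 := hs.2
    simp only [mem_preimage, min_eq_left Real.pi_pos.le, max_eq_right Real.pi_pos.le] at h2
    rw [mem_ofPred_eq, exp_im]
    exact mul_pos (Real.exp_pos _) (Real.sin_pos_of_mem_Ioo h2)

lemma continuousOn_dslope_of_differentiableAt {f : ℂ → ℂ} {s : Set ℂ} {a : ℂ}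
    (hf : ContinuousOn f s) (ha : DifferentiableAt ℂ f a) : ContinuousOn (dslope f a) s := by
  intro b hb
  by_cases h : b = a
  · rw [h]; exact (continuousAt_dslope_same.2 ha).continuousWithinAt
  · exact (continuousWithinAt_dslope_of_ne h).2 (hf b hb)

lemma dslope_im_eq_zero {f : ℂ → ℂ} {x : ℝ} (hx : 0 < x) (hd : DifferentiableAt ℂ f x)
    (hf : ∀ t : ℝ, 0 < t → (f t).im = 0) {t : ℝ} (ht : 0 < t) : (dslope f x t).im = 0 := by
  by_cases h : t = x
  · subst h
    rw [dslope_same]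
    have h1 : HasDerivAt (fun s : ℝ => (f s).im) (deriv f t).im t :=
      imCLM.hasFDerivAt.comp_hasDerivAt t hd.hasDerivAt.comp_ofReal
    have h2 : (fun s : ℝ => (f s).im) =ᶠ[𝓝 t] fun _ => 0 := by
      filter_upwards [lt_mem_nhds ht] with s hs using hf s hs
    exact h1.unique ((hasDerivAt_const t (0 : ℝ)).congr_of_eventuallyEq h2)
  · rw [dslope_of_ne _ (by exact_mod_cast h), slope_def_field, ← ofReal_sub, div_ofReal_im,
      sub_im, hf t ht, hf x hx, sub_zero, zero_div]

/-! ### The regularised kernel -/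

lemma exp_neg_lambertW {ζ : ℂ} (h : ζ ≠ 0) : exp (-lambertW ζ) = lambertW ζ / ζ := by
  rw [exp_neg, eq_div_iff h, inv_mul_eq_iff_eq_mul₀ (exp_ne_zero _), mul_comm, lambertW_mul_exp]

/-- The function `exp (-W(ζ)) * ((ζ - a) / (W(ζ) - W(a))) ^ 2`, with its removable singularity at
`ζ = a` filled in. Up to sign, both `F₀` and `F₁` are obtained from `lambertP a ζ / (ζ - a)`
by a Möbius substitution for `ζ`. -/
noncomputable def lambertP (a : ℝ) (ζ : ℂ) : ℂ :=
  exp (-lambertW ζ) * dslope (fun w : ℂ => w * exp w) (lambertW a) (lambertW ζ) ^ 2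

lemma lambertW_injective : Function.Injective lambertW := fun z w h => by
  rw [← lambertW_mul_exp z, h, lambertW_mul_exp]

lemma lambertP_of_ne {a : ℝ} {ζ : ℂ} (h : ζ ≠ a) :
    lambertP a ζ = exp (-lambertW ζ) * ((ζ - a) / (lambertW ζ - lambertW a)) ^ 2 := by
  rw [lambertP, dslope_of_ne _ (lambertW_injective.ne h), slope_def_field, lambertW_mul_exp,
    lambertW_mul_exp]

lemma differentiable_dslope_mul_exp (c : ℂ) :
    Differentiable ℂ (dslope (fun w : ℂ => w * exp w) c) := by
  rw [← differentiableOn_univ, differentiableOn_dslope univ_mem]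
  fun_prop

lemma differentiableOn_lambertP (a : ℝ) : DifferentiableOn ℂ (lambertP a) slitPlane := by
  unfold lambertP
  exact differentiableOn_lambertW.neg.cexp.mul
    (((differentiable_dslope_mul_exp _).comp_differentiableOn differentiableOn_lambertW).pow 2)

lemma differentiableAt_lambertP (a : ℝ) {ζ : ℂ} (hζ : ζ ∈ slitPlane) :
    DifferentiableAt ℂ (lambertP a) ζ :=
  (differentiableOn_lambertP a).differentiableAt (isOpen_slitPlane.mem_nhds hζ)

lemma continuousOn_lambertP (a : ℝ) : ContinuousOn (lambertP a) {ζ | 0 ≤ ζ.im} := by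
  unfold lambertP
  exact continuousOn_lambertW_closedUpper.neg.cexp.mul
    (((differentiable_dslope_mul_exp _).continuous.comp_continuousOn
      continuousOn_lambertW_closedUpper).pow 2)

lemma exists_lambertP_ofReal_eq {a x : ℝ} (ha : 0 < a) (hx : 0 < x) :
    ∃ p : ℝ, 0 < p ∧ lambertP a x = p := by
  obtain ⟨y, hy, hyx, hW⟩ := exists_lambertW_ofReal_eq hx
  obtain ⟨b, hb, hba, hWa⟩ := exists_lambertW_ofReal_eq ha
  by_cases h : x = a
  · subst h
    refine ⟨Real.exp (-y) * ((1 + y) * Real.exp y) ^ 2, by positivity, ?_⟩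
    rw [lambertP, dslope_same, (hasStrictDerivAt_mul_exp _).hasDerivAt.deriv, hW]
    push_cast
    rfl
  · refine ⟨Real.exp (-y) * ((x - a) / (y - b)) ^ 2, ?_, ?_⟩
    · have h1 : x - a ≠ 0 := sub_ne_zero.2 h
      have h2 : y - b ≠ 0 := sub_ne_zero.2 fun hh => h (by rw [← hyx, hh, hba])
      positivity
    · rw [lambertP_of_ne (by exact_mod_cast h), hW, hWa]
      push_cast
      rfl

/-- On the image `u sin v + v cos v = 0` of the branch cut one has `|w| = v / sin v ≥ 1`. -/
lemma one_le_normSq_of_im_mul_exp_eq_zero {w : ℂ} (h0 : 0 < w.im) (h1 : w.im < Real.pi)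
    (h : (w * exp w).im = 0) : 1 ≤ normSq w := by
  rw [im_mul_exp, mul_eq_zero, or_iff_right (Real.exp_pos _).ne'] at h
  have hs := Real.sin_pos_of_pos_of_lt_pi h0 h1
  have hsv := Real.sin_le h0.le
  have key : normSq w * Real.sin w.im ^ 2 = w.im ^ 2 := by
    rw [normSq_apply]
    linear_combination (w.re * Real.sin w.im - w.im * Real.cos w.im) * h +
      w.im ^ 2 * Real.sin_sq_add_cos_sq w.im
  have h2 : Real.sin w.im ^ 2 ≤ normSq w * Real.sin w.im ^ 2 := by
    rw [key]; exact pow_le_pow_left₀ hs.le hsv 2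
  exact le_of_mul_le_mul_right (by simpa using h2) (pow_pos hs 2)

lemma im_div_sub_sq (w : ℂ) (b : ℝ) :
    (w / (w - b) ^ 2).im = w.im * (b ^ 2 - normSq w) / normSq (w - b) ^ 2 := by
  have h : w / (w - b) ^ 2 = w * conj (w - b) ^ 2 / ((normSq (w - b) ^ 2 : ℝ) : ℂ) := by
    rw [ofReal_pow, ← mul_conj]
    by_cases h0 : w - b = 0
    · simp [h0]
    · have : conj (w - b) ≠ 0 := (map_ne_zero _).2 h0
      field_simp
  rw [h, div_ofReal_im]
  congr 1
  simp [pow_two, normSq_apply]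
  ring

/-- Here `a ≤ e` enters: it means `W(a) ≤ 1`, whereas `1 ≤ |w|` on the image of the cut. -/
lemma lambertP_neg_im_nonneg {a t : ℝ} (ha : 0 < a) (hae : a ≤ Real.exp 1) (ht : 0 < t) :
    0 ≤ (lambertP a (-(t : ℂ))).im := by
  obtain ⟨b, hb, hba, hWa⟩ := exists_lambertW_ofReal_eq ha
  have hb1 : b ≤ 1 := by
    rw [← strictMonoOn_mul_exp.le_iff_le (mem_Ici.2 (by linarith)) (mem_Ici.2 (by norm_num))]
    simpa [hba] using hae
  have ht0 : (t : ℂ) ≠ 0 := by exact_mod_cast ht.ne'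
  have hne : (-(t : ℂ)) ≠ a := by
    intro h
    have : -t = a := by exact_mod_cast h
    linarith
  obtain ⟨hU, hwt⟩ := lambertW_spec_of_im_nonneg (ζ := -(t : ℂ)) (by simp)
  set w := lambertW (-(t : ℂ)) with hw
  have hexp : exp (-w) = -(w / t) := by
    rw [hw, exp_neg_lambertW (neg_ne_zero.2 ht0), div_neg]
  have hP : lambertP a (-(t : ℂ)) = -(w / (w - b) ^ 2 * (((t + a) ^ 2 / t : ℝ) : ℂ)) := by
    rw [lambertP_of_ne hne, ← hw, hWa, hexp, div_pow]
    push_cast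
    ring
  rw [hP, neg_im, im_mul_ofReal, im_div_sub_sq]
  have hnn : w.im * (b ^ 2 - normSq w) ≤ 0 := by
    rcases hU.1.eq_or_lt with h0 | h0
    · rw [← h0, zero_mul]
    · have h1 := one_le_normSq_of_im_mul_exp_eq_zero h0 (im_lt_pi_of_mem_lambertUpper hU)
        (by rw [hwt]; simp)
      have : b ^ 2 ≤ 1 := pow_le_one₀ hb.le hb1
      exact mul_nonpos_of_nonneg_of_nonpos h0.le (by linarith)
  rw [← neg_mul]
  exact mul_nonneg (neg_nonneg.2 (div_nonpos_of_nonpos_of_nonneg hnn (by positivity)))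
    (by positivity)

/-- Since `exp (-W(ζ)) = W(ζ) / ζ`, the quotient is `W(ζ) (1 - a / ζ) / (W(ζ) - W(a)) ^ 2`, and
`W(ζ)` tends to infinity. -/
lemma tendsto_lambertP_div_cobounded {a : ℝ} :
    Tendsto (fun ζ => lambertP a ζ / (ζ - a)) (Bornology.cobounded ℂ) (𝓝 0) := by
  have hW : Tendsto lambertW (Bornology.cobounded ℂ) (Bornology.cobounded ℂ) :=
    tendsto_norm_atTop_iff_cobounded.1 tendsto_norm_lambertW
  have h1 : Tendsto (fun ζ : ℂ => 1 - a * ζ⁻¹) (Bornology.cobounded ℂ) (𝓝 (1 - a * 0)) :=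
    tendsto_const_nhds.sub (tendsto_inv₀_cobounded.const_mul _)
  have h2 : Tendsto (fun w : ℂ => (w - lambertW a)⁻¹) (Bornology.cobounded ℂ) (𝓝 0) :=
    tendsto_inv₀_cobounded.comp (tendsto_sub_const_cobounded _)
  have h3 : Tendsto (fun w : ℂ => (w - lambertW a)⁻¹ * (1 + lambertW a * (w - lambertW a)⁻¹))
      (Bornology.cobounded ℂ) (𝓝 (0 * (1 + lambertW a * 0))) :=
    h2.mul (tendsto_const_nhds.add (h2.const_mul _))
  have h4 := (h3.comp hW).mul h1
  simp only [zero_mul] at h4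
  refine h4.congr' ?_
  filter_upwards [Bornology.eventually_ne_cobounded (a : ℂ), Bornology.eventually_ne_cobounded 0]
    with ζ hζ h0
  have hd : lambertW ζ - lambertW a ≠ 0 := sub_ne_zero.2 (lambertW_injective.ne hζ)
  have hζ' : ζ - a ≠ 0 := sub_ne_zero.2 hζ
  rw [lambertP_of_ne hζ, exp_neg_lambertW h0]
  simp only [Function.comp]
  field_simp
  ring

/-! ### The integral representation of the divided difference -/

/-- The density of the representing measure in logarithmic coordinates: up to the factor `-1 / π`
the jump function `Im (lambertP a ζ / (ζ - a))` at `ζ = -exp y`, approached from above. -/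
noncomputable def lambertDensity (a y : ℝ) : ℝ :=
  (lambertP a (-(Real.exp y : ℝ))).im / (Real.pi * (Real.exp y + a))

lemma continuous_lambertDensity {a : ℝ} (ha : 0 < a) : Continuous (lambertDensity a) := by
  have h : Continuous fun y : ℝ => lambertP a (-(Real.exp y : ℝ)) := by
    rw [← continuousOn_univ]
    exact (continuousOn_lambertP a).comp (by fun_prop) fun y _ => by simp [-ofReal_exp]
  unfold lambertDensity
  refine (continuous_im.comp h).div (by fun_prop) fun y => ?_
  have := Real.pi_pos
  positivity

lemma lambertDensity_nonneg {a : ℝ} (ha : 0 < a) (hae : a ≤ Real.exp 1) (y : ℝ) :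
    0 ≤ lambertDensity a y := by
  have := Real.pi_pos
  exact div_nonneg (lambertP_neg_im_nonneg ha hae (Real.exp_pos y)) (by positivity)

lemma tendsto_integral_lambertDensity {a x : ℝ} (ha : 0 < a) (hx : 0 < x) :
    Tendsto (fun R : ℝ => ∫ y in (-R)..R,
      lambertDensity a y * (Real.exp y / (Real.exp y + x))) atTop
      (𝓝 (dslope (lambertP a) a x).re) := by
  have has : (a : ℂ) ∈ slitPlane := ofReal_mem_slitPlane.2 ha
  have hxs : (x : ℂ) ∈ slitPlane := ofReal_mem_slitPlane.2 hx
  set Q : ℂ → ℂ := dslope (lambertP a) a with hQ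
  have hQd : DifferentiableOn ℂ Q slitPlane :=
    (differentiableOn_dslope (isOpen_slitPlane.mem_nhds has)).2 (differentiableOn_lambertP a)
  have hQc : ContinuousOn Q {ζ | 0 ≤ ζ.im} :=
    continuousOn_dslope_of_differentiableAt (continuousOn_lambertP a)
      (differentiableAt_lambertP a has)
  have hQx : DifferentiableAt ℂ Q x := hQd.differentiableAt (isOpen_slitPlane.mem_nhds hxs)
  have hLd : DifferentiableOn ℂ (dslope Q x) slitPlane :=
    (differentiableOn_dslope (isOpen_slitPlane.mem_nhds hxs)).2 hQd
  have hLc : ContinuousOn (dslope Q x) {ζ | 0 ≤ ζ.im} :=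
    continuousOn_dslope_of_differentiableAt hQc hQx
  have hPreal : ∀ t : ℝ, 0 < t → (lambertP a t).im = 0 := fun t ht => by
    obtain ⟨p, -, hp⟩ := exists_lambertP_ofReal_eq ha ht
    rw [hp, ofReal_im]
  have hQreal : ∀ t : ℝ, 0 < t → (Q t).im = 0 := fun t ht =>
    dslope_im_eq_zero ha (differentiableAt_lambertP a has) hPreal ht
  have hLreal : ∀ t : ℝ, 0 < t → (dslope Q x t).im = 0 := fun t ht =>
    dslope_im_eq_zero hx hQx hQreal ht
  -- Cauchy's theorem is applied to `ζ * (Q ζ - Q x) / (ζ - x)`: it has no pole at `x`, is real on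
  -- the positive axis and tends to `-Q x` at infinity.
  have hΦc : ContinuousOn (fun ζ => ζ * dslope Q x ζ) {ζ | 0 ≤ ζ.im} := continuousOn_id.mul hLc
  have hsubinv : ∀ c : ℂ, Tendsto (fun ζ : ℂ => (ζ - c)⁻¹) (Bornology.cobounded ℂ) (𝓝 0) :=
    fun c => tendsto_inv₀_cobounded.comp (tendsto_sub_const_cobounded c)
  have hQinf : Tendsto Q (Bornology.cobounded ℂ) (𝓝 0) := by
    have h := (tendsto_lambertP_div_cobounded (a := a)).sub
      ((hsubinv a).const_mul (lambertP a a))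
    rw [mul_zero, sub_zero] at h
    refine h.congr' ?_
    filter_upwards [Bornology.eventually_ne_cobounded (a : ℂ)] with ζ hζ
    rw [hQ, dslope_of_ne _ hζ, slope_def_field]
    ring
  have hinf : Tendsto (fun ζ => ζ * dslope Q x ζ) (Bornology.cobounded ℂ) (𝓝 (-Q x)) := by
    have h := (hQinf.sub_const (Q x)).mul (((hsubinv x).const_mul (x : ℂ)).const_add 1)
    rw [mul_zero, add_zero, mul_one, zero_sub] at h
    refine h.congr' ?_
    filter_upwards [Bornology.eventually_ne_cobounded (x : ℂ)] with ζ hζ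
    have : ζ - x ≠ 0 := sub_ne_zero.2 hζ
    rw [dslope_of_ne _ hζ, slope_def_field]
    field_simp
    ring
  have hzero : Tendsto (fun ζ => ζ * dslope Q x ζ) (𝓝[{ζ | 0 ≤ ζ.im}] 0) (𝓝 0) := by
    have h : Tendsto (fun ζ => ζ * dslope Q x ζ) (𝓝[{ζ | 0 ≤ ζ.im}] 0)
      (𝓝 (0 * dslope Q x 0)) := hΦc 0 (by simp)
    rwa [zero_mul] at h
  have hlim := tendsto_integral_im_neg_exp (hΦc.mono sdiff_subset)
    ((differentiableOn_id.mul hLd).mono fun ζ (hζ : 0 < ζ.im) => Or.inr hζ.ne')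
    (fun t ht => by rw [im_ofReal_mul, hLreal t ht, mul_zero]) hinf hzero
  have hpi : Real.pi ≠ 0 := Real.pi_ne_zero
  have h := hlim.const_mul (-Real.pi⁻¹)
  have e : -Real.pi⁻¹ * (Real.pi * (-Q x).re) = (Q x).re := by
    rw [neg_re]; field_simp
  rw [e] at h
  refine h.congr fun R => ?_
  rw [← intervalIntegral.integral_const_mul]
  congr 1
  funext y
  have hEx : -((Real.exp y : ℝ) : ℂ) = ((-Real.exp y : ℝ) : ℂ) := by push_cast; rfl
  have hE := Real.exp_pos y
  have hQy : (Q (-(Real.exp y : ℝ))).im = -(Real.pi * lambertDensity a y) := by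
    have hne : (-(Real.exp y : ℝ) : ℂ) ≠ a := by
      rw [hEx]; exact_mod_cast (by linarith : -Real.exp y < a).ne
    obtain ⟨p, -, hp⟩ := exists_lambertP_ofReal_eq ha ha
    rw [hQ, dslope_of_ne _ hne, slope_def_field, lambertDensity, hp, hEx, ← ofReal_sub,
      div_ofReal_im, sub_im, ofReal_im, sub_zero]
    have h1 : -Real.exp y - a ≠ 0 := by linarith
    have h2 : Real.exp y + a ≠ 0 := by linarith
    field_simp
    ring
  have hne : (-(Real.exp y : ℝ) : ℂ) ≠ x := by
    rw [hEx]; exact_mod_cast (by linarith : -Real.exp y < x).ne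
  rw [dslope_of_ne _ hne, slope_def_field]
  have h1 : -Real.exp y - x ≠ 0 := by linarith
  have h2 : Real.exp y + x ≠ 0 := by linarith
  have : (-(Real.exp y : ℝ) : ℂ) * ((Q (-(Real.exp y : ℝ)) - Q x) / (-(Real.exp y : ℝ) - x)) =
      ((Real.exp y / (Real.exp y + x) : ℝ) : ℂ) * (Q (-(Real.exp y : ℝ)) - Q x) := by
    have h1' : (-(Real.exp y : ℝ) - x : ℂ) ≠ 0 := by rw [hEx]; exact_mod_cast h1
    have h2' : ((Real.exp y : ℝ) + x : ℂ) ≠ 0 := by exact_mod_cast h2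
    rw [ofReal_div, ofReal_add]
    field_simp
    ring
  rw [this, im_ofReal_mul, sub_im, hQreal x hx, hQy, sub_zero]
  field_simp

/-- The representation `(P(x) - P(a)) / (x - a) = ∫ ρ(t) / (x + t) dt`, with `t = exp y`. -/
lemma integrable_and_integral_lambertDensity {a x : ℝ} (ha : 0 < a) (hae : a ≤ Real.exp 1)
    (hx : 0 < x) :
    MeasureTheory.Integrable
      (fun y => lambertDensity a y * (Real.exp y / (Real.exp y + x))) ∧
    ∫ y, lambertDensity a y * (Real.exp y / (Real.exp y + x)) =
      (dslope (lambertP a) a x).re := by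
  have hlim := tendsto_integral_lambertDensity ha hx
  have hnn : ∀ y, 0 ≤ lambertDensity a y * (Real.exp y / (Real.exp y + x)) := fun y =>
    mul_nonneg (lambertDensity_nonneg ha hae y) (by positivity)
  have hcont : Continuous fun y => lambertDensity a y * (Real.exp y / (Real.exp y + x)) :=
    (continuous_lambertDensity ha).mul
      (Real.continuous_exp.div (by fun_prop) fun y => by positivity)
  have hint : MeasureTheory.Integrable
      (fun y => lambertDensity a y * (Real.exp y / (Real.exp y + x))) := by
    refine MeasureTheory.integrable_of_intervalIntegral_norm_tendsto
      (dslope (lambertP a) a x).re (l := atTop) (a := fun R : ℝ => -R) (b := id)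
      (fun R => (hcont.integrableOn_Icc).mono_set Ioc_subset_Icc_self)
      tendsto_neg_atTop_atBot tendsto_id ?_
    simpa only [Real.norm_of_nonneg (hnn _), id] using hlim
  exact ⟨hint, tendsto_nhds_unique
    (MeasureTheory.intervalIntegral_tendsto_integral hint tendsto_neg_atTop_atBot tendsto_id) hlim⟩

/-! ### Stieltjes functions given by a density along a parametrised half-line -/

/-- The measure consists of an atom of mass `A` at `0` and the image under `τ` of the measure with
density `k`. -/
lemma isStieltjesFunction_of_eq_add_integral {f : ℝ → ℝ} {c A : ℝ} {k τ : ℝ → ℝ} (hc : 0 ≤ c)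
    (hA : 0 ≤ A) (hk : Measurable k) (hk0 : ∀ y, 0 ≤ k y) (hτ : Measurable τ)
    (hτ0 : ∀ y, 0 ≤ τ y)
    (hint : ∀ x : ℝ, 0 < x → MeasureTheory.Integrable fun y => k y * (x + τ y)⁻¹)
    (hf : ∀ x : ℝ, 0 < x → f x = c + (A / x + ∫ y, k y * (x + τ y)⁻¹)) :
    IsStieltjesFunction f := by
  set ν : MeasureTheory.Measure ℝ :=
    MeasureTheory.volume.withDensity fun y => ENNReal.ofReal (k y) with hν
  have hkm : Measurable fun y => ENNReal.ofReal (k y) := hk.ennreal_ofReal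
  have hmeas : ∀ x : ℝ, Measurable fun t : ℝ => (x + t)⁻¹ := fun x => by fun_prop
  have hint1 : ∀ x : ℝ, 0 < x →
      MeasureTheory.Integrable (fun t : ℝ => (x + t)⁻¹) (ν.map τ) := fun x hx => by
    rw [MeasureTheory.integrable_map_measure (hmeas x).aestronglyMeasurable hτ.aemeasurable, hν,
      MeasureTheory.integrable_withDensity_iff_integrable_smul' hkm (by simp)]
    simpa [ENNReal.toReal_ofReal (hk0 _)] using hint x hx
  have hint2 : ∀ x : ℝ, 0 < x → MeasureTheory.Integrable (fun t : ℝ => (x + t)⁻¹)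
      (ENNReal.ofReal A • MeasureTheory.Measure.dirac (0 : ℝ)) := fun x hx =>
    (MeasureTheory.integrable_dirac (by simp)).smul_measure ENNReal.ofReal_ne_top
  refine ⟨c, hc, ENNReal.ofReal A • MeasureTheory.Measure.dirac 0 + ν.map τ, ?_,
    (hint2 1 one_pos).add_measure (hint1 1 one_pos), fun x hx => ?_⟩
  · have h : τ ⁻¹' Iio 0 = ∅ := by
      ext y; simpa using hτ0 y
    simp [MeasureTheory.Measure.map_apply hτ measurableSet_Iio, h]
  · rw [hf x hx, MeasureTheory.integral_add_measure (hint2 x hx) (hint1 x hx),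
      MeasureTheory.integral_smul_measure, MeasureTheory.integral_dirac,
      MeasureTheory.integral_map hτ.aemeasurable (hmeas x).aestronglyMeasurable, hν,
      integral_withDensity_eq_integral_toReal_smul hkm (by simp)]
    simp [ENNReal.toReal_ofReal (hk0 _), ENNReal.toReal_ofReal hA, div_eq_mul_inv]

/-! ### The two functions -/

lemma slitPlane_one_add_ne_zero {z : ℂ} (hz : z ∈ slitPlane) : 1 + z ≠ 0 := fun h => by
  have e : z = ((-1 : ℝ) : ℂ) := by push_cast; linear_combination h
  rw [e, ofReal_mem_slitPlane] at hz
  linarith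

lemma mul_one_add_mem_slitPlane {a : ℝ} (ha : 0 < a) {z : ℂ} (hz : z ∈ slitPlane) :
    (a : ℂ) * (1 + z) ∈ slitPlane := by
  rcases hz with h | h
  · left; simp; positivity
  · right; simpa using ⟨ha.ne', h⟩

lemma div_one_add_mem_slitPlane {a : ℝ} (ha : 0 < a) {z : ℂ} (hz : z ∈ slitPlane) :
    (a : ℂ) / (1 + z) ∈ slitPlane := by
  have h1 := mul_one_add_mem_slitPlane one_pos hz
  rw [ofReal_one, one_mul] at h1
  have h0 := slitPlane_one_add_ne_zero hz
  have hn : 0 < normSq (1 + z) := normSq_pos.2 h0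
  rw [div_eq_mul_inv]
  rcases h1 with h | h
  · left; rw [re_ofReal_mul, inv_re]; positivity
  · right; rw [im_ofReal_mul, inv_im]
    exact mul_ne_zero ha.ne' (div_ne_zero (neg_ne_zero.2 h) hn.ne')

lemma sokalF0_eq {a : ℝ} (ha : 0 < a) {z : ℂ} (hz : z ∈ slitPlane) :
    sokalF0 a z = lambertP a (a * (1 + z)) / (a * z) := by
  have ha' : (a : ℂ) ≠ 0 := by exact_mod_cast ha.ne'
  have hz0 : z ≠ 0 := slitPlane_ne_zero hz
  have h1 := slitPlane_one_add_ne_zero hz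
  have hne : (a : ℂ) * (1 + z) ≠ a := fun h => hz0 (by
    have : (a : ℂ) * z = 0 := by linear_combination h
    exact (mul_eq_zero.1 this).resolve_left ha')
  have hd := sub_ne_zero.2 (lambertW_injective.ne hne)
  rw [lambertP_of_ne hne, exp_neg_lambertW (mul_ne_zero ha' h1), sokalF0]
  field_simp
  ring

lemma sokalF1_eq {a : ℝ} (ha : 0 < a) {z : ℂ} (hz : z ∈ slitPlane) :
    sokalF1 a z = lambertP a (a / (1 + z)) * (1 + z) / (a * z) := by
  have ha' : (a : ℂ) ≠ 0 := by exact_mod_cast ha.ne'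
  have hz0 : z ≠ 0 := slitPlane_ne_zero hz
  have h1 := slitPlane_one_add_ne_zero hz
  have hne : (a : ℂ) / (1 + z) ≠ a := fun h => hz0 (by
    rw [div_eq_iff h1] at h
    have : (a : ℂ) * z = 0 := by linear_combination -h
    exact (mul_eq_zero.1 this).resolve_left ha')
  have hd := sub_ne_zero.2 (lambertW_injective.ne hne)
  rw [lambertP_of_ne hne, exp_neg_lambertW (div_ne_zero ha' h1), sokalF1,
    ← neg_sub (lambertW (a / (1 + z))), neg_sq]
  field_simp
  ring

lemma differentiableOn_sokalF0 {a : ℝ} (ha : 0 < a) :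
    DifferentiableOn ℂ (sokalF0 a) slitPlane := by
  have ha' : (a : ℂ) ≠ 0 := by exact_mod_cast ha.ne'
  refine DifferentiableOn.congr (f := fun z => lambertP a (a * (1 + z)) / (a * z)) ?_
    fun z hz => sokalF0_eq ha hz
  refine DifferentiableOn.div ?_ (by fun_prop) fun z hz => mul_ne_zero ha' (slitPlane_ne_zero hz)
  exact (differentiableOn_lambertP a).comp (by fun_prop) fun z hz => mul_one_add_mem_slitPlane ha hz

lemma differentiableOn_sokalF1 {a : ℝ} (ha : 0 < a) :
    DifferentiableOn ℂ (sokalF1 a) slitPlane := by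
  have ha' : (a : ℂ) ≠ 0 := by exact_mod_cast ha.ne'
  refine DifferentiableOn.congr
    (f := fun z => lambertP a (a / (1 + z)) * (1 + z) / (a * z)) ?_ fun z hz => sokalF1_eq ha hz
  refine DifferentiableOn.div ?_ (by fun_prop) fun z hz => mul_ne_zero ha' (slitPlane_ne_zero hz)
  refine DifferentiableOn.mul ?_ (by fun_prop)
  refine (differentiableOn_lambertP a).comp ?_ fun z hz => div_one_add_mem_slitPlane ha hz
  exact (differentiableOn_const _).div (by fun_prop) fun z hz => slitPlane_one_add_ne_zero hz

/-- `lambertP a` on the positive axis in terms of its value at `a` and the density. -/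
lemma lambertP_ofReal_eq {a x : ℝ} (ha : 0 < a) (hae : a ≤ Real.exp 1) (hx : 0 < x)
    (hxa : x ≠ a) :
    lambertP a x = (((lambertP a a).re + (x - a) *
      ∫ y, lambertDensity a y * (Real.exp y / (Real.exp y + x)) : ℝ) : ℂ) := by
  obtain ⟨p, -, hp⟩ := exists_lambertP_ofReal_eq ha hx
  obtain ⟨q, -, hq⟩ := exists_lambertP_ofReal_eq ha ha
  rw [(integrable_and_integral_lambertDensity ha hae hx).2,
    dslope_of_ne _ (by exact_mod_cast hxa), slope_def_field, hp, hq]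
  have h : x - a ≠ 0 := sub_ne_zero.2 hxa
  rw [← ofReal_sub, ← ofReal_sub, ← ofReal_div, ofReal_re, ofReal_re]
  congr 1
  field_simp
  ring

/-- Positivity of `lambertP` near the origin bounds the total mass of the density. -/
lemma integrable_lambertDensity_and_integral_le {a : ℝ} (ha : 0 < a) (hae : a ≤ Real.exp 1) :
    MeasureTheory.Integrable (lambertDensity a) ∧
      ∫ y, lambertDensity a y ≤ (lambertP a a).re / a := by
  set A := (lambertP a a).re with hA
  have hA0 : 0 < A := by
    obtain ⟨q, hq0, hq⟩ := exists_lambertP_ofReal_eq ha ha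
    rwa [hA, hq, ofReal_re]
  have hg := continuous_lambertDensity ha
  have hg0 := lambertDensity_nonneg ha hae
  have hbound : ∀ x : ℝ, 0 < x → x < a →
      ∫ y, lambertDensity a y * (Real.exp y / (Real.exp y + x)) ≤ A / (a - x) := by
    intro x hx hxa
    obtain ⟨p, hp0, hp⟩ := exists_lambertP_ofReal_eq ha hx
    have h := lambertP_ofReal_eq ha hae hx hxa.ne
    rw [hp, ofReal_inj] at h
    rw [le_div_iff₀ (by linarith)]
    linarith
  let u : ℕ → ℝ := fun n => a / (n + 2)
  have hu : ∀ n, 0 < u n := fun n => by simp only [u]; positivity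
  have hua : ∀ n, u n < a := fun n => div_lt_self ha (by
    have : (0 : ℝ) ≤ n := n.cast_nonneg
    linarith)
  have hulim : Tendsto u atTop (𝓝 0) :=
    tendsto_const_nhds.div_atTop (tendsto_natCast_atTop_atTop.atTop_add tendsto_const_nhds)
  -- Fatou's lemma as `u n` tends to `0` gives integrability and the bound at once.
  let F : ℕ → ℝ → ENNReal := fun n y =>
    ENNReal.ofReal (lambertDensity a y * (Real.exp y / (Real.exp y + u n)))
  have hFmeas : ∀ n, Measurable (F n) := fun n => by
    have := hg.measurable
    simp only [F]
    fun_prop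
  have hFlim : ∀ y, Tendsto (fun n => F n y) atTop (𝓝 (ENNReal.ofReal (lambertDensity a y))) := by
    intro y
    refine ENNReal.tendsto_ofReal ?_
    have : Tendsto (fun n => lambertDensity a y * (Real.exp y / (Real.exp y + u n))) atTop
        (𝓝 (lambertDensity a y * (Real.exp y / (Real.exp y + 0)))) :=
      (tendsto_const_nhds.div (hulim.const_add _) (by simp [Real.exp_ne_zero])).const_mul _
    simpa [Real.exp_ne_zero] using this
  have hFint : ∀ n, ∫⁻ y, F n y ≤ ENNReal.ofReal (A / (a - u n)) := fun n => by
    have h := (integrable_and_integral_lambertDensity ha hae (hu n)).1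
    rw [← MeasureTheory.ofReal_integral_eq_lintegral_ofReal h
      (Eventually.of_forall fun y => mul_nonneg (hg0 y)
        (div_nonneg (Real.exp_pos y).le (add_pos (Real.exp_pos y) (hu n)).le))]
    exact ENNReal.ofReal_le_ofReal (hbound _ (hu n) (hua n))
  have hlim : Tendsto (fun n => ENNReal.ofReal (A / (a - u n))) atTop
      (𝓝 (ENNReal.ofReal (A / a))) := by
    refine ENNReal.tendsto_ofReal ?_
    have : Tendsto (fun n => A / (a - u n)) atTop (𝓝 (A / (a - 0))) :=
      tendsto_const_nhds.div (tendsto_const_nhds.sub hulim) (by simpa using ha.ne')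
    simpa using this
  have hle : ∫⁻ y, ENNReal.ofReal (lambertDensity a y) ≤ ENNReal.ofReal (A / a) := by
    calc ∫⁻ y, ENNReal.ofReal (lambertDensity a y)
        = ∫⁻ y, liminf (fun n => F n y) atTop := by simp only [(hFlim _).liminf_eq]
      _ ≤ liminf (fun n => ∫⁻ y, F n y) atTop := MeasureTheory.lintegral_liminf_le hFmeas
      _ ≤ liminf (fun n => ENNReal.ofReal (A / (a - u n))) atTop :=
        liminf_le_liminf (Eventually.of_forall hFint)
      _ = ENNReal.ofReal (A / a) := hlim.liminf_eq
  have hint : MeasureTheory.Integrable (lambertDensity a) :=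
    (MeasureTheory.lintegral_ofReal_ne_top_iff_integrable hg.aestronglyMeasurable
      (Eventually.of_forall hg0)).1 (ne_top_of_le_ne_top ENNReal.ofReal_ne_top hle)
  refine ⟨hint, ?_⟩
  rw [← MeasureTheory.ofReal_integral_eq_lintegral_ofReal hint (Eventually.of_forall hg0)] at hle
  exact (ENNReal.ofReal_le_ofReal_iff (by positivity)).1 hle

lemma isStieltjesOnCutPlane_sokalF0 {a : ℝ} (ha : 0 < a) (hae : a ≤ Real.exp 1) :
    IsStieltjesOnCutPlane (sokalF0 a) := by
  have hA0 : 0 < (lambertP a a).re := by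
    obtain ⟨q, hq0, hq⟩ := exists_lambertP_ofReal_eq ha ha
    rwa [hq, ofReal_re]
  -- For `t = exp y` the kernel `1 / (a (1 + x) + t)` is `a⁻¹ / (x + (1 + t / a))`.
  set k : ℝ → ℝ := fun y => lambertDensity a y * Real.exp y / a with hk
  set τ : ℝ → ℝ := fun y => 1 + Real.exp y / a with hτ
  have hker : ∀ x : ℝ, 0 < x → (fun y => k y * (x + τ y)⁻¹) =
      fun y => lambertDensity a y * (Real.exp y / (Real.exp y + a * (1 + x))) := by
    intro x hx
    funext y
    have := Real.exp_pos y
    simp only [hk, hτ]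
    field_simp
    ring
  refine ⟨differentiableOn_sokalF0 ha,
    fun x => 0 + ((lambertP a a).re / a / x + ∫ y, k y * (x + τ y)⁻¹), ?_, ?_⟩
  · have := (continuous_lambertDensity ha).measurable
    refine isStieltjesFunction_of_eq_add_integral (k := k) (τ := τ) le_rfl
      (div_nonneg hA0.le ha.le) (by fun_prop) (fun y => ?_) (by fun_prop) (fun y => by positivity)
      (fun x hx => ?_) fun x hx => rfl
    · exact div_nonneg (mul_nonneg (lambertDensity_nonneg ha hae y) (Real.exp_pos y).le) ha.le
    · rw [hker x hx]
      exact (integrable_and_integral_lambertDensity ha hae (by positivity)).1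
  · intro x hx
    have hne : a * (1 + x) ≠ a := by nlinarith
    have h := lambertP_ofReal_eq ha hae (by positivity : 0 < a * (1 + x)) hne
    push_cast at h
    simp only [hker x hx]
    rw [sokalF0_eq ha (ofReal_mem_slitPlane.2 hx), h]
    have ha' : (a : ℂ) ≠ 0 := by exact_mod_cast ha.ne'
    have hx' : (x : ℂ) ≠ 0 := by exact_mod_cast hx.ne'
    push_cast
    field_simp
    ring

lemma isStieltjesOnCutPlane_sokalF1 {a : ℝ} (ha : 0 < a) (hae : a ≤ Real.exp 1) :
    IsStieltjesOnCutPlane (sokalF1 a) := by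
  have hA0 : 0 < (lambertP a a).re := by
    obtain ⟨q, hq0, hq⟩ := exists_lambertP_ofReal_eq ha ha
    rwa [hq, ofReal_re]
  obtain ⟨hgint, hgle⟩ := integrable_lambertDensity_and_integral_le ha hae
  -- For `t = exp y` one has `t / (t + a / (1 + x)) = 1 - (a / t) / (x + (1 + a / t))`.
  set k : ℝ → ℝ := fun y => lambertDensity a y * (a / Real.exp y) with hk
  set τ : ℝ → ℝ := fun y => 1 + a / Real.exp y with hτ
  have hker : ∀ x : ℝ, 0 < x → (fun y => k y * (x + τ y)⁻¹) =
      fun y => lambertDensity a y -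
        lambertDensity a y * (Real.exp y / (Real.exp y + a / (1 + x))) := by
    intro x hx
    funext y
    have := Real.exp_pos y
    simp only [hk, hτ]
    field_simp
    ring
  have hint : ∀ x : ℝ, 0 < x → MeasureTheory.Integrable fun y =>
      lambertDensity a y * (Real.exp y / (Real.exp y + a / (1 + x))) := fun x hx =>
    (integrable_and_integral_lambertDensity ha hae (by positivity)).1
  refine ⟨differentiableOn_sokalF1 ha,
    fun x => ((lambertP a a).re / a - ∫ y, lambertDensity a y) +
      ((lambertP a a).re / a / x + ∫ y, k y * (x + τ y)⁻¹), ?_, ?_⟩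
  · have := (continuous_lambertDensity ha).measurable
    refine isStieltjesFunction_of_eq_add_integral (k := k) (τ := τ) (by linarith)
      (div_nonneg hA0.le ha.le) (by fun_prop) (fun y => ?_) (by fun_prop) (fun y => by positivity)
      (fun x hx => ?_) fun x hx => rfl
    · exact mul_nonneg (lambertDensity_nonneg ha hae y) (by positivity)
    · rw [hker x hx]
      exact hgint.sub (hint x hx)
  · intro x hx
    have hlt : a / (1 + x) < a := div_lt_self ha (by linarith)
    have h := lambertP_ofReal_eq ha hae (by positivity : 0 < a / (1 + x)) hlt.ne
    push_cast at h
    simp only [hker x hx]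
    rw [MeasureTheory.integral_sub hgint (hint x hx),
      sokalF1_eq ha (ofReal_mem_slitPlane.2 hx), h]
    generalize (∫ y, lambertDensity a y * (Real.exp y / (Real.exp y + a / (1 + x)))) = J
    have ha' : (a : ℂ) ≠ 0 := by exact_mod_cast ha.ne'
    have hx' : (x : ℂ) ≠ 0 := by exact_mod_cast hx.ne'
    have hx1 : (1 + x : ℂ) ≠ 0 := slitPlane_one_add_ne_zero (ofReal_mem_slitPlane.2 hx)
    push_cast
    field_simp
    ring

theorem mainTheorem1 (a : ℝ) (ha : 0 < a) (hae : a ≤ Real.exp 1) :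
    IsStieltjesOnCutPlane (sokalF0 a) ∧ IsStieltjesOnCutPlane (sokalF1 a) :=
  ⟨isStieltjesOnCutPlane_sokalF0 ha hae, isStieltjesOnCutPlane_sokalF1 ha hae⟩
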